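/- Let $k\in\tfrac12+\mathbb Z$ be a half-integer and let $h$ be a nonzero integer. For odd $d$ put $\varepsilon_d=1$ if $d\equiv1\bmod 4$ and $\varepsilon_d=i$ if $d\equiv3\bmod4$, write $e(x)=e^{2\pi i x}$, let $\left(\frac{\cdot}{\cdot}\right)$ be the Kronecker symbol, and for $c\ge1$ define the Gauss sum $$g_h(4c)=\sum_{d\bmod 4c}\varepsilon_d^{2k}\left(\frac{4c}{d}\right)e\!\left(\frac{hd}{4c}\right)$$ (only odd $d$ contribute). Let $\chi_{k,h}$ be the quadratic Dirichlet character $n\mapsto\left(\frac{(-1)^{k-1/2}h}{n}\right)$ modulo $4|h|$. For a Dirichlet character $\chi$ and $Q\ge1$ let $L^{(Q)}(s,\chi)$ and $\zeta^{(Q)}(s)$ denote $L(s,\chi)$ and $\zeta(s)$ with the Euler factors at the primes dividing $Q$ removed, where $\zeta^{(2h)}$ means $\zeta^{(2|h|)}$. Then there is a finite Dirichlet polynomial $\widetilde D_\infty^k(h,w)=\sum_{n\ge 1}a(n)n^{-2w}$, with finitely many nonzero coefficients $a(n)\in\mathbb C$ depending only on $k$ and $h$, such that for all $w\in\mathbb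 C$ with $\operatorname{Re}w>\tfrac34$ the series on the left converges absolutely and $$\sum_{c\ge1}\frac{g_h(4c)}{(4c)^{2w}}=\frac{L^{(2)}(2w-\tfrac12,\chi_{k,h})}{\zeta^{(2h)}(4w-1)}\,\widetilde D_\infty^k(h,w).$$ The same holds, with a possibly different finite Dirichlet polynomial, if $\chi_{k,h}$ is taken to be the primitive quadratic character attached to the extension $\mathbb Q\big(\sqrt{(-1)^{k-1/2}h}\big)/\mathbb Q$, i.e. the primitive character that induces the one above (the trivial character if $(-1)^{k-1/2}h$ is a square). -/

import Mathlib

/-- The Kronecker symbol `(a / n)` for an integer `a` and a natural number `n`: it is completely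
multiplicative in `n`, the Jacobi symbol for odd `n`, `(a / 2) = χ₈(a)` (that is `0` for even `a`,
`1` for `a ≡ ±1 mod 8`, `-1` for `a ≡ ±3 mod 8`), and `(a / 0)` is `1` if `a = ±1` and `0`
otherwise. -/
def kroneckerSym (a : ℤ) (n : ℕ) : ℤ :=
  if n = 0 then (if a.natAbs = 1 then 1 else 0)
  else ZMod.χ₈ (a : ZMod 8) ^ n.factorization 2 * jacobiSym a (n / 2 ^ n.factorization 2)

/-- On odd `n` the Kronecker symbol is the Jacobi symbol. -/
theorem kroneckerSym_odd (a : ℤ) {n : ℕ} (hn : Odd n) : kroneckerSym a n = jacobiSym a n := by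
  have h2 : ¬ 2 ∣ n := by
    rw [Nat.two_dvd_ne_zero]
    exact Nat.odd_iff.mp hn
  have h0 : n ≠ 0 := by
    rintro rfl
    exact h2 (dvd_zero 2)
  rw [kroneckerSym, if_neg h0, Nat.factorization_eq_zero_of_not_dvd h2]
  simp

/-- The sign `ε_d` of the quadratic Gauss sum: `1` if `d ≡ 1 mod 4` and `i` if `d ≡ 3 mod 4`.
Even `d` never contribute; the value there is set to `0`. -/
noncomputable def epsSign (d : ℕ) : ℂ :=
  if d % 4 = 1 then 1 else if d % 4 = 3 then Complex.I else 0

/-- The Gauss sum `g_h(q) = ∑_{d mod q} ε_d^{2k} (q/d) e(hd/q)` of half-integral weight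
`k = m + 1/2`, so that `2k = 2m + 1`; here `e(x) = exp(2πix)`. -/
noncomputable def halfGaussSum (m h : ℤ) (q : ℕ) : ℂ :=
  ∑ d ∈ Finset.range q, epsSign d ^ (2 * m + 1) * (kroneckerSym (q : ℤ) d : ℂ) *
    Complex.exp (2 * Real.pi * Complex.I * ((h : ℂ) * (d : ℂ) / (q : ℂ)))

/-- The integer `(-1)^{k - 1/2} h` for the weight `k = m + 1/2`. -/
def twistedInt (m h : ℤ) : ℤ := (Int.negOnePow m : ℤ) * h

theorem natAbs_twistedInt (m h : ℤ) : (twistedInt m h).natAbs = h.natAbs := by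
  rw [twistedInt, Int.natAbs_mul]
  simp

/-- The quadratic Dirichlet character `n ↦ (a / n)` modulo `4|a|`, where `a ≠ 0`. -/
noncomputable def quadraticSymbolChar (a : ℤ) [NeZero a] :
    DirichletCharacter ℂ (4 * a.natAbs) where
  toFun x := open scoped Classical in if IsUnit x then (kroneckerSym a x.val : ℂ) else 0
  map_one' := by
    have h1 : 1 < 4 * a.natAbs := by
      have := Int.natAbs_pos.mpr (NeZero.ne a)
      omega
    haveI : Fact (1 < 4 * a.natAbs) := ⟨h1⟩
    rw [if_pos isUnit_one, ZMod.val_one, kroneckerSym_odd a odd_one, jacobiSym.one_right]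
    simp
  map_mul' x y := by
    have hodd : ∀ z : ZMod (4 * a.natAbs), IsUnit z → Odd z.val := by
      intro z hz
      have h := (ZMod.isUnit_iff_coprime z.val _).mp (by rwa [ZMod.natCast_zmod_val])
      have h' : Nat.Coprime z.val 2 := h.coprime_dvd_right ⟨2 * a.natAbs, by ring⟩
      exact Nat.coprime_two_right.mp h'
    by_cases hx : IsUnit x
    · by_cases hy : IsUnit y
      · have ox := hodd x hx
        have oy := hodd y hy
        haveI : NeZero x.val := ⟨ox.pos.ne'⟩
        haveI : NeZero y.val := ⟨oy.pos.ne'⟩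
        rw [if_pos (hx.mul hy), if_pos hx, if_pos hy, kroneckerSym_odd a (hodd _ (hx.mul hy)),
          kroneckerSym_odd a ox, kroneckerSym_odd a oy, ZMod.val_mul,
          ← jacobiSym.mod_right a (ox.mul oy), jacobiSym.mul_right]
        push_cast
        ring
      · rw [if_neg (fun h => hy (isUnit_of_mul_isUnit_right h)), if_neg hy, mul_zero]
    · rw [if_neg (fun h => hx (isUnit_of_mul_isUnit_left h)), if_neg hx, zero_mul]
  map_nonunit' x hx := if_neg hx

instance neZero_twistedInt (m h : ℤ) [NeZero h] : NeZero (twistedInt m h) :=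
  ⟨by
    intro h0
    have := natAbs_twistedInt m h
    rw [h0] at this
    exact NeZero.ne h (Int.natAbs_eq_zero.mp this.symm)⟩

instance neZero_conductor {N : ℕ} [NeZero N] (χ : DirichletCharacter ℂ N) : NeZero χ.conductor :=
  ⟨χ.conductor_ne_zero⟩

/-- The character `χ_{k,h} = ((-1)^{k - 1/2} h / ·)`, for `k = m + 1/2`, as a Dirichlet character
modulo `4|h|`. -/
noncomputable def chiSymbol (m h : ℤ) [NeZero h] :
    DirichletCharacter ℂ (4 * (twistedInt m h).natAbs) :=
  quadraticSymbolChar (twistedInt m h)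

/-- The primitive quadratic character attached to the extension `ℚ(√((-1)^{k - 1/2} h)) / ℚ`, for
`k = m + 1/2`: the primitive character inducing `((-1)^{k - 1/2} h / ·)`. -/
noncomputable def chiField (m h : ℤ) [NeZero h] : DirichletCharacter ℂ (chiSymbol m h).conductor :=
  (chiSymbol m h).primitiveCharacter

/-- `L^{(Q)}(s, χ)`: the Dirichlet `L`-function without its Euler factors at the primes dividing
`Q`. -/
noncomputable def partialLFunction {N : ℕ} [NeZero N] (Q : ℕ) (χ : DirichletCharacter ℂ N)
    (s : ℂ) : ℂ :=
  χ.LFunction s * ∏ p ∈ Q.primeFactors, (1 - χ (p : ZMod N) * (p : ℂ) ^ (-s))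

/-- `ζ^{(Q)}(s)`: the Riemann zeta function without its Euler factors at the primes dividing
`Q`. -/
noncomputable def partialZeta (Q : ℕ) (s : ℂ) : ℂ :=
  riemannZeta s * ∏ p ∈ Q.primeFactors, (1 - (p : ℂ) ^ (-s))

/-- The finite Dirichlet polynomial `∑ a(n) n^{-s}`, where `a(n) ≠ 0` for finitely many `n`. -/
noncomputable def dirichletPolynomial (a : ℕ+ →₀ ℂ) (s : ℂ) : ℂ :=
  a.sum fun n c => c * ((n : ℕ) : ℂ) ^ (-s)

/-!
Fix `c ≥ 1`. If `n` is squarefree and coprime to `2hc`, the Chinese remainder theorem and quadratic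
reciprocity split `g_h(4cn)` into `g_h(4c)` and a quadratic Gauss sum modulo `n`. The sign of that
Gauss sum cancels the signs `ε_d`, and there remains `g_h(4cn) = χ(n) √n g_h(4c)` with
`χ = χ_{k,h}`. The sign itself comes from writing the Gauss sum as an alternating sum of Gaussian
binomial coefficients at a root of unity, which is a product of sines. On the other hand
`g_h(4c) = 0` as soon as `b ^ (j + 1)` divides `c` for some `b` such that `b ^ j` does not divide
`h`, because a translation of `d` multiplies the sum by a root of unity `≠ 1`.

Write `c = u n` with `u = gcd(c, 2h²)`. By the vanishing criterion only those `c` contribute for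
which `n` is squarefree and coprime to `2h`. The finitely many `u ∣ 2h²` give a Dirichlet
polynomial, and an Euler product gives `∑ χ(n) n^{-s} = L(s, χ) / L(2s, χ²)` over squarefree `n`,
where `s = 2w - 1/2`. The primitive character changes `L(s, χ)` by finitely many Euler factors.
-/

section GaussianBinomial

variable {R : Type*} [CommRing R]

/-- The Gaussian binomial coefficient `[n, k]_q`, defined by Pascal's rule so that it makes sense
in every commutative ring, including at roots of unity. -/
def gaussBinom (q : R) : ℕ → ℕ → R
  | _, 0 => 1
  | 0, _ + 1 => 0
  | n + 1, k + 1 => gaussBinom q n k + q ^ (k + 1) * gaussBinom q n (k + 1)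

@[simp]
theorem gaussBinom_zero_right (q : R) (n : ℕ) : gaussBinom q n 0 = 1 := by cases n <;> rfl

theorem gaussBinom_succ_succ (q : R) (n k : ℕ) :
    gaussBinom q (n + 1) (k + 1) = gaussBinom q n k + q ^ (k + 1) * gaussBinom q n (k + 1) :=
  rfl

theorem gaussBinom_eq_zero_of_lt (q : R) {n k : ℕ} (h : n < k) : gaussBinom q n k = 0 := by
  induction n generalizing k with
  | zero => obtain ⟨k, rfl⟩ := Nat.exists_eq_add_one.mpr h; rfl
  | succ n ih =>
    obtain ⟨k, rfl⟩ := Nat.exists_eq_add_one.mpr (n.succ_pos.trans h)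
    rw [gaussBinom_succ_succ, ih (by omega), ih (by omega), mul_zero, add_zero]

theorem one_sub_pow_mul_gaussBinom_succ_succ (q : R) (n k : ℕ) :
    (1 - q ^ (k + 1)) * gaussBinom q (n + 1) (k + 1) = (1 - q ^ (n + 1)) * gaussBinom q n k := by
  induction n generalizing k with
  | zero => cases k <;> simp [gaussBinom]
  | succ n ih =>
    rw [gaussBinom_succ_succ]
    cases k with
    | zero =>
      simp only [gaussBinom_zero_right]
      linear_combination q * ih 0 + q * (1 - q ^ (n + 1)) * gaussBinom_zero_right q n
    | succ k =>
      linear_combination q ^ (k + 2) * ih (k + 1) + q * ih k -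
        q * (1 - q ^ (n + 1)) * gaussBinom_succ_succ q n k

/-- The terms `[n + 1, k]_q` telescope, which leaves one term from either end. -/
theorem sum_neg_one_pow_mul_gaussBinom_add_two (q : R) (n : ℕ) :
    ∑ k ∈ Finset.range (n + 3), (-1) ^ k * gaussBinom q (n + 2) k =
      (1 - q ^ (n + 1)) * ∑ k ∈ Finset.range (n + 1), (-1) ^ k * gaussBinom q n k := by
  set u : ℕ → R := fun k => (-1) ^ k * gaussBinom q (n + 1) k with hu
  have hstep (k : ℕ) : (-1) ^ (k + 1) * gaussBinom q (n + 2) (k + 1) =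
      u (k + 1) - u k + (1 - q ^ (n + 1)) * ((-1) ^ k * gaussBinom q n k) := by
    rw [gaussBinom_succ_succ]
    linear_combination (-1) ^ k * one_sub_pow_mul_gaussBinom_succ_succ q n k
  have htop : gaussBinom q n (n + 1) = 0 := gaussBinom_eq_zero_of_lt q (Nat.lt_succ_self n)
  have hu_top : u (n + 2) = 0 := by
    simp only [hu, gaussBinom_eq_zero_of_lt q (Nat.lt_succ_self (n + 1)), mul_zero]
  rw [Finset.sum_range_succ', Finset.sum_congr rfl fun k _ => hstep k, Finset.sum_add_distrib,
    Finset.sum_range_sub, ← Finset.mul_sum, Finset.sum_range_succ _ (n + 1), htop, hu_top]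
  simp [hu]

theorem sum_neg_one_pow_mul_gaussBinom (q : R) (n : ℕ) :
    ∑ k ∈ Finset.range (2 * n + 1), (-1) ^ k * gaussBinom q (2 * n) k =
      ∏ i ∈ Finset.range n, (1 - q ^ (2 * i + 1)) := by
  induction n with
  | zero => simp
  | succ n ih =>
    rw [Finset.prod_range_succ, ← ih, mul_comm (Finset.sum _ _)]
    exact sum_neg_one_pow_mul_gaussBinom_add_two q (2 * n)

/-- At a primitive `(n + 1)`-st root of unity the coefficients `[n + 1, k]_q` with `0 < k < n + 1`
vanish, so Pascal's rule determines `[n, k]_q` recursively. -/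
theorem gaussBinom_sq_mul_pow_of_isPrimitiveRoot [IsDomain R] {η : R} {n k : ℕ}
    (hη : IsPrimitiveRoot (η ^ 2) (n + 1)) (hk : k ≤ n) :
    gaussBinom (η ^ 2) n k * η ^ (k ^ 2 + k) = (-1) ^ k := by
  induction k with
  | zero => simp
  | succ k ih =>
    have habsorb := one_sub_pow_mul_gaussBinom_succ_succ (η ^ 2) n k
    rw [hη.pow_eq_one, sub_self, zero_mul] at habsorb
    have hne : 1 - (η ^ 2) ^ (k + 1) ≠ 0 :=
      sub_ne_zero.mpr (hη.pow_ne_one_of_pos_of_lt k.succ_ne_zero (by omega)).symm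
    have hpascal := (mul_eq_zero.mp habsorb).resolve_left hne
    rw [gaussBinom_succ_succ] at hpascal
    rw [pow_succ (-1 : R), ← ih (by omega)]
    linear_combination η ^ (k ^ 2 + k) * hpascal

end GaussianBinomial

theorem sum_range_add_of_periodic {M : Type*} [AddCommMonoid M] [IsRightCancelAdd M] {f : ℕ → M}
    {N : ℕ} (hf : Function.Periodic f N) (t : ℕ) :
    ∑ d ∈ Finset.range N, f (d + t) = ∑ d ∈ Finset.range N, f d := by
  induction t with
  | zero => rfl
  | succ t ih =>
    apply add_right_cancel (b := f t)
    have hsucc := Finset.sum_range_succ (fun d => f (d + t)) N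
    have hsucc' := Finset.sum_range_succ' (fun d => f (d + t)) N
    rw [hsucc, ih, zero_add, add_comm N t, hf t] at hsucc'
    rw [hsucc']
    exact congrArg (· + f t) (Finset.sum_congr rfl fun d _ => congrArg f (by ring))

section QuadraticGaussSum

theorem prod_range_pow_two_mul_add_one {M : Type*} [CommMonoid M] (x : M) (n : ℕ) :
    ∏ i ∈ Finset.range n, x ^ (2 * i + 1) = x ^ n ^ 2 := by
  induction n with
  | zero => simp
  | succ n ih => rw [Finset.prod_range_succ, ih, ← pow_add]; congr 1; ring

theorem sum_pow_sq_of_isPrimitiveRoot {K : Type*} [Field K] {ω : K} {n : ℕ}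
    (hω : IsPrimitiveRoot ω (2 * n + 1)) :
    ∑ k ∈ Finset.range (2 * n + 1), ω ^ k ^ 2 =
      ∏ i ∈ Finset.range n, (ω ^ (2 * i + 1) - (ω ^ (2 * i + 1))⁻¹) := by
  have hω₀ : ω ≠ 0 := hω.ne_zero (by omega)
  have hη : IsPrimitiveRoot (ω⁻¹ ^ 2) (2 * n + 1) := hω.inv.pow_of_coprime 2 (by simp)
  have hperiodic : Function.Periodic (fun k => ω ^ k ^ 2) (2 * n + 1) := fun k => by
    simp only
    rw [show (k + (2 * n + 1)) ^ 2 = k ^ 2 + (2 * n + 1) * (2 * k + 2 * n + 1) by ring, pow_add,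
      pow_mul ω (2 * n + 1), hω.pow_eq_one, one_pow, mul_one]
  have hsquare (k : ℕ) : ω ^ (k + (n + 1)) ^ 2 = ω ^ n ^ 2 * ω ^ (k ^ 2 + k) := by
    rw [show (k + (n + 1)) ^ 2 = n ^ 2 + (k ^ 2 + k) + (2 * n + 1) * (k + 1) by ring, pow_add,
      pow_mul ω (2 * n + 1), hω.pow_eq_one, one_pow, mul_one, pow_add]
  have hbinom : ∀ k ∈ Finset.range (2 * n + 1),
      ω ^ (k ^ 2 + k) = (-1) ^ k * gaussBinom (ω⁻¹ ^ 2) (2 * n) k := fun k hk => by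
    have h := gaussBinom_sq_mul_pow_of_isPrimitiveRoot hη (Finset.mem_range_succ_iff.mp hk)
    rw [inv_pow ω (k ^ 2 + k), ← div_eq_mul_inv, div_eq_iff (pow_ne_zero _ hω₀)] at h
    rw [h, ← mul_assoc, ← mul_pow, neg_one_mul, neg_neg, one_pow, one_mul]
  calc ∑ k ∈ Finset.range (2 * n + 1), ω ^ k ^ 2
      = ω ^ n ^ 2 * ∑ k ∈ Finset.range (2 * n + 1), ω ^ (k ^ 2 + k) := by
        rw [← sum_range_add_of_periodic hperiodic (n + 1), Finset.mul_sum]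
        exact Finset.sum_congr rfl fun k _ => hsquare k
    _ = ω ^ n ^ 2 * ∏ i ∈ Finset.range n, (1 - (ω⁻¹ ^ 2) ^ (2 * i + 1)) := by
        rw [Finset.sum_congr rfl hbinom, sum_neg_one_pow_mul_gaussBinom]
    _ = ∏ i ∈ Finset.range n, (ω ^ (2 * i + 1) - (ω ^ (2 * i + 1))⁻¹) := by
        rw [← prod_range_pow_two_mul_add_one, ← Finset.prod_mul_distrib]
        refine Finset.prod_congr rfl fun i _ => ?_
        rw [← inv_pow, pow_right_comm]
        have : ω ^ (2 * i + 1) * ω⁻¹ ^ (2 * i + 1) = 1 := by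
          rw [← mul_pow, mul_inv_cancel₀ hω₀, one_pow]
        linear_combination - ω⁻¹ ^ (2 * i + 1) * this

theorem isPrimitiveRoot_neg_exp (n : ℕ) :
    IsPrimitiveRoot (-Complex.exp (Real.pi * Complex.I / (2 * n + 1))) (2 * n + 1) := by
  have hroot := (Complex.isPrimitiveRoot_exp (2 * n + 1) (by omega)).pow_of_coprime (n + 1) (by
    rw [show 2 * n + 1 = n + (n + 1) by ring]
    simp)
  convert! hroot using 1
  have hn : (2 * n + 1 : ℂ) ≠ 0 := by exact_mod_cast (2 * n).succ_ne_zero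
  rw [← mul_neg_one, ← Complex.exp_pi_mul_I, ← Complex.exp_add, ← Complex.exp_nat_mul]
  congr 1
  push_cast
  field_simp
  ring

theorem exists_pos_sum_neg_exp_pow_sq (n : ℕ) :
    ∃ r : ℝ, 0 < r ∧ ∑ k ∈ Finset.range (2 * n + 1),
      (-Complex.exp (Real.pi * Complex.I / (2 * n + 1))) ^ k ^ 2 = (-Complex.I) ^ n * r := by
  refine ⟨∏ i ∈ Finset.range n, (2 * Real.sin ((2 * i + 1) * Real.pi / (2 * n + 1))),
    Finset.prod_pos fun i hi => mul_pos two_pos ?_, ?_⟩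
  · have hi : (i : ℝ) + 1 ≤ n := by exact_mod_cast Finset.mem_range.mp hi
    refine Real.sin_pos_of_pos_of_lt_pi (by positivity) ?_
    rw [div_lt_iff₀ (by positivity)]
    nlinarith [Real.pi_pos]
  · have hI : (-Complex.I) ^ n = ∏ _i ∈ Finset.range n, -Complex.I := by simp
    rw [sum_pow_sq_of_isPrimitiveRoot (isPrimitiveRoot_neg_exp n), hI, Complex.ofReal_prod,
      ← Finset.prod_mul_distrib]
    refine Finset.prod_congr rfl fun i _ => ?_
    have hpow : (-Complex.exp (Real.pi * Complex.I / (2 * n + 1))) ^ (2 * i + 1) =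
        -Complex.exp ((2 * i + 1) * Real.pi / (2 * n + 1) * Complex.I) := by
      rw [Odd.neg_pow ⟨i, rfl⟩, ← Complex.exp_nat_mul]
      congr 2
      push_cast
      ring
    rw [hpow, inv_neg, ← Complex.exp_neg]
    push_cast
    rw [Complex.sin, neg_mul ((2 * i + 1 : ℂ) * Real.pi / (2 * n + 1))]
    linear_combination (Complex.exp (-((2 * i + 1) * Real.pi / (2 * n + 1) * Complex.I))
      - Complex.exp ((2 * i + 1) * Real.pi / (2 * n + 1) * Complex.I)) * Complex.I_sq

end QuadraticGaussSum

theorem sum_range_zmod_natCast {M : Type*} [AddCommMonoid M] {N : ℕ} [NeZero N] (f : ZMod N → M) :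
    ∑ k ∈ Finset.range N, f k = ∑ x, f x :=
  Finset.sum_nbij' (fun k => (k : ZMod N)) ZMod.val (fun _ _ => Finset.mem_univ _)
    (fun x _ => Finset.mem_range.mpr (ZMod.val_lt x))
    (fun _ hk => ZMod.val_cast_of_lt (Finset.mem_range.mp hk)) (fun x _ => ZMod.natCast_zmod_val x)
    fun _ _ => rfl

section QuadraticCharacter

variable (F R : Type*) [Field F] [Fintype F] [DecidableEq F] [CommRing R]

/-- The quadratic character of a finite field `F` with values in a commutative ring `R`. -/
def quadraticMulChar : MulChar F R :=
  (quadraticChar F).ringHomComp (Int.castRingHom R)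

variable {F R}

theorem isQuadratic_quadraticMulChar : (quadraticMulChar F R).IsQuadratic :=
  (quadraticChar_isQuadratic F).comp _

theorem quadraticMulChar_ne_one [CharZero R] (hF : ringChar F ≠ 2) : quadraticMulChar F R ≠ 1 :=
  (MulChar.ringHomComp_ne_one_iff (RingHom.injective_int _)).mpr (quadraticChar_ne_one hF)

theorem quadraticMulChar_intCast {p : ℕ} [Fact p.Prime] (a : ℤ) :
    quadraticMulChar (ZMod p) R a = jacobiSym a p := by
  rw [← jacobiSym.legendreSym.to_jacobiSym]
  rfl

/-- An element `d` has `1 + χ(d)` square roots. -/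
theorem sum_addChar_sq [IsDomain R] (hF : ringChar F ≠ 2) {ψ : AddChar F R} (hψ : ψ ≠ 1) :
    ∑ x, ψ (x ^ 2) = gaussSum (quadraticMulChar F R) ψ := by
  have hcount (d : F) : ∑ x : F with x ^ 2 = d, ψ d = (quadraticMulChar F R d + 1) * ψ d := by
    have hcard := congrArg (Int.cast : ℤ → R) (quadraticChar_card_sqrts hF d)
    rw [Set.toFinset_ofPred] at hcard
    rw [Finset.sum_const, nsmul_eq_mul]
    push_cast at hcard
    rw [hcard]
    rfl
  rw [← Finset.sum_fiberwise' Finset.univ (· ^ 2), Finset.sum_congr rfl fun d _ => hcount d]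
  simp only [add_one_mul, Finset.sum_add_distrib, AddChar.sum_eq_zero_of_ne_one hψ, add_zero,
    gaussSum]

end QuadraticCharacter

section GaussSumSign

theorem epsSign_two_mul_add_one (n : ℕ) :
    epsSign (2 * n + 1) = ZMod.χ₈ (2 * n + 1 : ℕ) * (-Complex.I) ^ n := by
  have hI : (-Complex.I) ^ n = (-Complex.I) ^ (n % 4) := by
    conv_lhs => rw [← Nat.div_add_mod n 4, pow_add, pow_mul, Even.neg_pow (by decide),
      Complex.I_pow_four, one_pow, one_mul]
  have hI₃ : (-Complex.I) ^ 3 = Complex.I := by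
    rw [Odd.neg_pow (by decide), Complex.I_pow_three, neg_neg]
  rw [hI, ZMod.χ₈_nat_eq_if_mod_eight, if_neg (by omega), epsSign]
  have hmod : n % 4 < 4 := Nat.mod_lt _ (by norm_num)
  interval_cases h : n % 4
  · simp [show (2 * n + 1) % 8 = 1 by omega, show (2 * n + 1) % 4 = 1 by omega]
  · simp [show (2 * n + 1) % 8 = 3 by omega, show (2 * n + 1) % 4 = 3 by omega]
  · simp [show (2 * n + 1) % 8 = 5 by omega, show (2 * n + 1) % 4 = 1 by omega]
  · simp [show (2 * n + 1) % 8 = 7 by omega, show (2 * n + 1) % 4 = 3 by omega, hI₃]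

theorem norm_epsSign {d : ℕ} (hd : Odd d) : ‖epsSign d‖ = 1 := by
  rcases Nat.odd_mod_four_iff.mp (Nat.odd_iff.mp hd) with h | h <;> simp [epsSign, h]

theorem epsSign_ne_zero {d : ℕ} (hd : Odd d) : epsSign d ≠ 0 :=
  norm_ne_zero_iff.mp (norm_epsSign hd ▸ one_ne_zero)

theorem stdAddChar_add_one_eq_neg_exp (n : ℕ) :
    ZMod.stdAddChar (n + 1 : ZMod (2 * n + 1)) =
      -Complex.exp (Real.pi * Complex.I / (2 * n + 1)) := by
  have h := ZMod.stdAddChar_coe (N := 2 * n + 1) (n + 1 : ℕ)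
  rw [Int.cast_natCast, Nat.cast_add_one] at h
  rw [h, ← mul_neg_one, ← Complex.exp_pi_mul_I, ← Complex.exp_add]
  congr 1
  have hn : (2 * n + 1 : ℂ) ≠ 0 := by exact_mod_cast (2 * n).succ_ne_zero
  push_cast
  field_simp
  ring

/-- The frequency `1 / 2` turns the roots of unity in the Gauss sum into the `-exp(πi / p)` powers
for which its sign is visible; passing back to frequency `1` costs the factor `χ(2) = χ₈(p)`. -/
theorem exists_pos_gaussSum_eq_epsSign_mul {p : ℕ} [hp : Fact p.Prime] (hp₂ : p ≠ 2) :
    ∃ r : ℝ, 0 < r ∧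
      gaussSum (quadraticMulChar (ZMod p) ℂ) ZMod.stdAddChar = epsSign p * r := by
  obtain ⟨n, rfl⟩ := hp.out.odd_of_ne_two hp₂
  obtain ⟨r, hr, hsum⟩ := exists_pos_sum_neg_exp_pow_sq n
  refine ⟨r, hr, ?_⟩
  set χ := quadraticMulChar (ZMod (2 * n + 1)) ℂ
  have hhalf : (n + 1 : ZMod (2 * n + 1)) * 2 = 1 := by
    have hzero := ZMod.natCast_self (2 * n + 1)
    push_cast at hzero
    linear_combination hzero
  have hχ_half : χ (n + 1) = ZMod.χ₈ (2 * n + 1 : ℕ) := by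
    rw [eq_inv_of_mul_eq_one_left hhalf, ← MulChar.inv_apply', isQuadratic_quadraticMulChar.inv,
      ← jacobiSym.at_two ⟨n, rfl⟩]
    exact quadraticMulChar_intCast 2
  have hfreq : (ZMod.stdAddChar (N := 2 * n + 1)).mulShift (n + 1 : ZMod (2 * n + 1)) ≠ 1 :=
    ZMod.isPrimitive_stdAddChar _ (left_ne_zero_of_mul_eq_one hhalf)
  have hgauss := sum_addChar_sq (by rwa [ZMod.ringChar_zmod_n]) hfreq
  rw [← sum_range_zmod_natCast] at hgauss
  rw [← gaussSum_mulShift χ _ (Units.mkOfMulEqOne _ _ hhalf), Units.val_mkOfMulEqOne, hχ_half,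
    ← hgauss, epsSign_two_mul_add_one, mul_assoc, ← hsum]
  congr 1
  refine Finset.sum_congr rfl fun k _ => ?_
  rw [AddChar.mulShift_apply, ← stdAddChar_add_one_eq_neg_exp, ← AddChar.map_nsmul_eq_pow]
  congr 1
  rw [nsmul_eq_mul]
  push_cast
  ring

theorem gaussSum_quadraticMulChar {p : ℕ} [hp : Fact p.Prime] (hp₂ : p ≠ 2) :
    gaussSum (quadraticMulChar (ZMod p) ℂ) ZMod.stdAddChar = epsSign p * √p := by
  obtain ⟨r, hr, hgauss⟩ := exists_pos_gaussSum_eq_epsSign_mul hp₂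
  have hchar : ringChar (ZMod p) ≠ 2 := by rwa [ZMod.ringChar_zmod_n]
  have hsq := gaussSum_sq (quadraticMulChar_ne_one (R := ℂ) hchar) isQuadratic_quadraticMulChar
    (ZMod.isPrimitive_stdAddChar p)
  have hnorm : ‖quadraticMulChar (ZMod p) ℂ (-1)‖ = 1 := by
    rcases isQuadratic_quadraticMulChar (F := ZMod p) (R := ℂ) (-1) with h | h | h
    · exact absurd h (isUnit_one.neg.map (quadraticMulChar (ZMod p) ℂ)).ne_zero
    · simp [h]
    · simp [h]
  have hr_sq := congrArg norm hsq
  rw [hgauss, norm_pow, norm_mul, norm_epsSign (hp.out.odd_of_ne_two hp₂), one_mul, norm_mul, hnorm,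
    one_mul, ZMod.card, Complex.norm_natCast, Complex.norm_of_nonneg hr.le] at hr_sq
  rw [hgauss, ← hr_sq, Real.sqrt_sq hr.le]

end GaussSumSign

section ExpTwoPiI

/-- The additive character `e(x) = exp(2πix)`. -/
noncomputable def expTwoPiI (x : ℂ) : ℂ :=
  Complex.exp (2 * Real.pi * Complex.I * x)

theorem expTwoPiI_add (x y : ℂ) : expTwoPiI (x + y) = expTwoPiI x * expTwoPiI y := by
  rw [expTwoPiI, mul_add, Complex.exp_add, expTwoPiI, expTwoPiI]

theorem expTwoPiI_eq_one_iff {x : ℂ} : expTwoPiI x = 1 ↔ ∃ n : ℤ, x = n := by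
  rw [expTwoPiI, Complex.exp_eq_one_iff]
  refine exists_congr fun n => ?_
  rw [mul_comm (n : ℂ)]
  exact mul_right_inj' Complex.two_pi_I_ne_zero

end ExpTwoPiI

section JacobiGaussSum

/-- The Gauss sum `∑_{y mod n} (y/n) e(hy/n)` attached to the Jacobi symbol. -/
noncomputable def jacobiGaussSum (h : ℤ) (n : ℕ) : ℂ :=
  ∑ y ∈ Finset.range n, (jacobiSym y n : ℂ) * expTwoPiI ((h : ℂ) * y / n)

theorem jacobiGaussSum_prime {p : ℕ} (hp : p.Prime) (hp₂ : p ≠ 2) {h : ℤ} (hh : ¬ (p : ℤ) ∣ h) :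
    jacobiGaussSum h p = jacobiSym h p * (epsSign p * √p) := by
  have : Fact p.Prime := ⟨hp⟩
  have hunit : (h : ZMod p) ≠ 0 := by rwa [Ne, ZMod.intCast_zmod_eq_zero_iff_dvd]
  rw [← gaussSum_quadraticMulChar hp₂, ← quadraticMulChar_intCast (R := ℂ),
    ← isQuadratic_quadraticMulChar.inv, ← Units.val_mk0 hunit]
  nth_rw 2 [isQuadratic_quadraticMulChar.inv]
  rw [← gaussSum_mulShift_eq, gaussSum, ← sum_range_zmod_natCast, jacobiGaussSum]
  refine Finset.sum_congr rfl fun y _ => ?_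
  have hψ := ZMod.stdAddChar_coe (N := p) (h * y)
  have hχ := quadraticMulChar_intCast (p := p) (R := ℂ) y
  push_cast at hψ hχ
  rw [AddChar.mulShift_apply, Units.val_mk0, hψ, hχ, expTwoPiI,
    mul_div_assoc (2 * Real.pi * Complex.I)]

end JacobiGaussSum

section EpsSign

theorem epsSign_eq_zero_of_even {d : ℕ} (hd : Even d) : epsSign d = 0 := by
  have := Nat.even_iff.mp hd
  rw [epsSign, if_neg (by omega), if_neg (by omega)]

theorem epsSign_congr {d e : ℕ} (h : d ≡ e [MOD 4]) : epsSign d = epsSign e := by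
  rw [epsSign, epsSign, h]

theorem epsSign_zpow (m : ℤ) (d : ℕ) :
    epsSign d ^ (2 * m + 1) = jacobiSym (Int.negOnePow m) d * epsSign d := by
  rcases Nat.even_or_odd d with hd | hd
  · rw [epsSign_eq_zero_of_even hd, zero_zpow _ (by omega), mul_zero]
  have hε_sq : epsSign d ^ (2 : ℤ) = jacobiSym (-1) d := by
    rw [jacobiSym.at_neg_one hd, epsSign]
    rcases Nat.odd_mod_four_iff.mp (Nat.odd_iff.mp hd) with h | h
    · simp [h, ZMod.χ₄_nat_one_mod_four h]
    · simp [h, ZMod.χ₄_nat_three_mod_four h]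
  rw [zpow_add₀ (epsSign_ne_zero hd), zpow_mul, zpow_one, hε_sq]
  congr 1
  have hsign : jacobiSym (-1) d = 1 ∨ jacobiSym (-1) d = -1 :=
    jacobiSym.eq_one_or_neg_one (by simp)
  rcases Int.even_or_odd m with hm | hm
  · rw [Int.negOnePow_even m hm, Units.val_one, jacobiSym.one_left]
    rcases hsign with h | h <;> simp [h, hm.neg_one_zpow]
  · rw [Int.negOnePow_odd m hm, Units.val_neg, Units.val_one]
    rcases hsign with h | h <;> simp [h, hm.neg_one_zpow]

/-- The signs `ε` form a coboundary for the quadratic reciprocity sign. -/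
theorem epsSign_mul_qrSign_mul_epsSign {x n d : ℕ} (hx : Odd x) (hn : Odd n)
    (hd : d ≡ x * n [MOD 4]) : epsSign d * qrSign d n * epsSign n = epsSign x := by
  have hd_odd : Odd d := Nat.odd_iff.mpr
    (Eq.trans (hd.of_dvd (by norm_num : 2 ∣ 4)) (Nat.odd_iff.mp (hx.mul hn)))
  rw [qrSign.symm hd_odd hn, qrSign]
  have hd' : d % 4 = x % 4 * (n % 4) % 4 := hd.trans (Nat.mul_mod x n 4)
  rcases Nat.odd_mod_four_iff.mp (Nat.odd_iff.mp hn) with hn₄ | hn₄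
  · simp [epsSign, hd', hn₄, ZMod.χ₄_nat_one_mod_four hn₄]
  · rw [ZMod.χ₄_nat_three_mod_four hn₄, jacobiSym.at_neg_one hd_odd, ZMod.χ₄_nat_eq_if_mod_four]
    rcases Nat.odd_mod_four_iff.mp (Nat.odd_iff.mp hx) with hx₄ | hx₄ <;>
      simp [epsSign, hd', hn₄, hx₄, Nat.odd_iff.mp hd_odd]

end EpsSign

section HalfGaussSum

variable (m h : ℤ) {c : ℕ}

/-- The summand of `halfGaussSum m h (4 * c)`. The exponent `2k` of `ε_d` has been traded for the
sign `(-1)^{k - 1/2}` in the Jacobi symbol; the summand vanishes at even `d` because `ε_d` does. -/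
noncomputable def halfGaussTerm (c d : ℕ) : ℂ :=
  epsSign d * (jacobiSym (twistedInt m c) d : ℂ) * expTwoPiI ((h : ℂ) * d / (4 * c : ℕ))

theorem halfGaussTerm_eq_zero_of_even {d : ℕ} (hd : Even d) : halfGaussTerm m h c d = 0 := by
  rw [halfGaussTerm, epsSign_eq_zero_of_even hd, zero_mul, zero_mul]

theorem sum_halfGaussTerm :
    ∑ d ∈ Finset.range (4 * c), halfGaussTerm m h c d = halfGaussSum m h (4 * c) := by
  refine Finset.sum_congr rfl fun d _ => ?_
  rcases Nat.even_or_odd d with hd | hd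
  · rw [halfGaussTerm_eq_zero_of_even m h hd, epsSign_eq_zero_of_even hd, zero_zpow _ (by omega),
      zero_mul, zero_mul]
  · rw [halfGaussTerm, epsSign_zpow, kroneckerSym_odd _ hd, twistedInt, jacobiSym.mul_left]
    push_cast
    rw [jacobiSym.mul_left, jacobiSym.at_four hd, one_mul, expTwoPiI]
    ring

theorem jacobiSym_add_right {a : ℤ} {d t : ℕ} (hd : Odd d) (ht : 4 * a.natAbs ∣ t) :
    jacobiSym a (d + t) = jacobiSym a d := by
  obtain ⟨s, rfl⟩ := ht
  have heven : Even (4 * a.natAbs * s) := ⟨2 * a.natAbs * s, by ring⟩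
  rw [jacobiSym.mod_right a (hd.add_even heven), jacobiSym.mod_right a hd,
    Nat.add_mul_mod_self_left]

variable {m h}

theorem halfGaussTerm_add {d t : ℕ} (ht : 4 ∣ t)
    (hsymbol : Odd d → jacobiSym (twistedInt m c) (d + t) = jacobiSym (twistedInt m c) d) :
    halfGaussTerm m h c (d + t) =
      expTwoPiI ((h : ℂ) * t / (4 * c : ℕ)) * halfGaussTerm m h c d := by
  rcases Nat.even_or_odd d with hd | hd
  · have ht₂ : Even t := even_iff_two_dvd.mpr ((by norm_num : 2 ∣ 4).trans ht)
    rw [halfGaussTerm_eq_zero_of_even m h hd, halfGaussTerm_eq_zero_of_even m h (hd.add ht₂),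
      mul_zero]
  · have hd_add : d + t ≡ d [MOD 4] := by
      obtain ⟨s, rfl⟩ := ht
      exact Nat.add_mul_mod_self_left d 4 s
    rw [halfGaussTerm, halfGaussTerm, hsymbol hd, epsSign_congr hd_add, Nat.cast_add, mul_add,
      add_div, expTwoPiI_add]
    ring

variable (m h)

theorem halfGaussTerm_periodic (hc : c ≠ 0) :
    Function.Periodic (halfGaussTerm m h c) (4 * c) := fun d => by
  have hexp : expTwoPiI ((h : ℂ) * (4 * c : ℕ) / (4 * c : ℕ)) = 1 :=
    expTwoPiI_eq_one_iff.mpr ⟨h, mul_div_cancel_right₀ _ (by exact_mod_cast (by omega))⟩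
  rw [halfGaussTerm_add (dvd_mul_right 4 c) fun hd => jacobiSym_add_right hd
    (by rw [natAbs_twistedInt, Int.natAbs_natCast]), hexp, one_mul]

/-- Write `c = b ^ (j + 1) * r`. Translating `d` by `4 * b * r` preserves the Jacobi symbols of `b`
and `r`, and multiplies the sum by `e(h / b ^ j) ≠ 1`. -/
theorem halfGaussSum_eq_zero_of_pow_dvd {b j : ℕ} (hbc : b ^ (j + 1) ∣ c)
    (hbh : ¬ ((b ^ j : ℕ) : ℤ) ∣ h) : halfGaussSum m h (4 * c) = 0 := by
  rcases eq_or_ne c 0 with rfl | hc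
  · exact Finset.sum_range_zero _
  obtain ⟨r, hcr⟩ := hbc
  have hbr : b ^ (j + 1) * r ≠ 0 := hcr ▸ hc
  have hr : (r : ℂ) ≠ 0 := by exact_mod_cast right_ne_zero_of_mul hbr
  have hb : (b : ℂ) ≠ 0 := by
    exact_mod_cast ne_zero_of_dvd_ne_zero (left_ne_zero_of_mul hbr) (dvd_pow_self b j.succ_ne_zero)
  have hsplit : twistedInt m c = (b : ℤ) ^ (j + 1) * twistedInt m r := by
    rw [twistedInt, twistedInt, hcr]
    push_cast
    ring
  have hsymbol (d : ℕ) (hd : Odd d) :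
      jacobiSym (twistedInt m c) (d + 4 * b * r) = jacobiSym (twistedInt m c) d := by
    have hb_add := jacobiSym_add_right (a := b) hd (t := 4 * b * r) ⟨r, rfl⟩
    have hr_add := jacobiSym_add_right (a := twistedInt m r) hd (t := 4 * b * r)
      ⟨b, by rw [natAbs_twistedInt, Int.natAbs_natCast]; ring⟩
    rw [hsplit, jacobiSym.mul_left, jacobiSym.mul_left, jacobiSym.pow_left, jacobiSym.pow_left,
      hb_add, hr_add]
  have hexp : expTwoPiI ((h : ℂ) * (4 * b * r : ℕ) / (4 * c : ℕ)) ≠ 1 := by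
    rw [Ne, expTwoPiI_eq_one_iff]
    rintro ⟨n, hn⟩
    refine hbh ⟨n, ?_⟩
    rw [hcr] at hn
    push_cast at hn
    field_simp at hn
    rw [pow_succ, mul_right_comm] at hn
    exact_mod_cast mul_right_cancel₀ hb hn
  have htranslate := sum_range_add_of_periodic (halfGaussTerm_periodic m h hc) (4 * b * r)
  rw [Finset.sum_congr rfl fun d _ => halfGaussTerm_add ⟨b * r, by ring⟩ (hsymbol d),
    ← Finset.mul_sum, sum_halfGaussTerm] at htranslate
  exact (mul_left_eq_self₀.mp htranslate).resolve_left hexp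

theorem sum_range_mul_of_periodic {M : Type*} [AddCommMonoid M] {f : ℕ → M} {a b : ℕ} (ha : a ≠ 0)
    (hb : b ≠ 0) (hab : a.Coprime b) (hf : Function.Periodic f (a * b)) :
    ∑ d ∈ Finset.range (a * b), f d =
      ∑ x ∈ Finset.range a, ∑ y ∈ Finset.range b, f (x * b + a * y) := by
  rw [← Finset.sum_product', eq_comm]
  have hmaps : ∀ z ∈ Finset.range a ×ˢ Finset.range b,
      (z.1 * b + a * z.2) % (a * b) ∈ Finset.range (a * b) := fun z _ =>
    Finset.mem_range.mpr (Nat.mod_lt _ (Nat.pos_of_ne_zero (mul_ne_zero ha hb)))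
  have hinj : Set.InjOn (fun z : ℕ × ℕ => (z.1 * b + a * z.2) % (a * b))
      (Finset.range a ×ˢ Finset.range b : Finset (ℕ × ℕ)) := by
    rintro ⟨x, y⟩ hz ⟨x', y'⟩ hz' h
    simp only [Finset.coe_product, Set.mem_prod, Finset.mem_coe, Finset.mem_range] at hz hz'
    have h : x * b + a * y ≡ x' * b + a * y' [MOD a * b] := h
    have hx : x * b ≡ x' * b [MOD a] := by
      simpa [Nat.ModEq, Nat.add_mul_mod_self_left] using h.of_dvd (dvd_mul_right a b)
    have hy : a * y ≡ a * y' [MOD b] := by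
      simpa [Nat.ModEq, Nat.mul_add_mod_self_right] using h.of_dvd (dvd_mul_left b a)
    exact Prod.ext ((hx.cancel_right_of_coprime hab).eq_of_lt_of_lt hz.1 hz'.1)
      ((hy.cancel_left_of_coprime hab.symm).eq_of_lt_of_lt hz.2 hz'.2)
  exact Finset.sum_nbij _ hmaps hinj (Finset.surjOn_of_injOn_of_card_le _ hmaps hinj (by simp))
    fun z _ => (hf.map_mod_nat _).symm

theorem jacobiSym_twistedInt_mul {n x : ℕ} (hn : Odd n) (hnc : n.Coprime c) (hx : Odd x) (y : ℕ) :
    jacobiSym (twistedInt m (c * n : ℕ)) (x * n + 4 * c * y) =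
      jacobiSym (Int.negOnePow m) n * jacobiSym (twistedInt m c) x *
        (qrSign (x * n + 4 * c * y) n * jacobiSym y n) := by
  have hxn := hx.mul hn
  have hd : Odd (x * n + 4 * c * y) := hxn.add_even ⟨2 * c * y, by ring⟩
  have : NeZero x := ⟨hx.pos.ne'⟩
  have : NeZero n := ⟨hn.pos.ne'⟩
  have hsplit : twistedInt m (c * n : ℕ) = twistedInt m c * n := by
    rw [twistedInt, twistedInt, Nat.cast_mul, mul_assoc]
  have hmod : jacobiSym (x * n + 4 * c * y : ℕ) n = jacobiSym c n * jacobiSym y n := by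
    rw [jacobiSym.mod_left' (a₂ := 4 * c * y) (by push_cast; simp), jacobiSym.mul_left,
      jacobiSym.mul_left, jacobiSym.at_four hn, one_mul]
  have hc_sq : jacobiSym c n ^ 2 = 1 := jacobiSym.sq_one (by simpa using hnc.symm)
  rw [hsplit, jacobiSym.mul_left, jacobiSym.quadratic_reciprocity' hn hd, hmod,
    jacobiSym_add_right hxn ⟨y, by rw [natAbs_twistedInt, Int.natAbs_natCast]⟩, jacobiSym.mul_right,
    twistedInt, jacobiSym.mul_left _ _ n]
  linear_combination jacobiSym (Int.negOnePow m) n * jacobiSym (Int.negOnePow m * c) x *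
    qrSign (x * n + 4 * c * y) n * jacobiSym y n * hc_sq

theorem epsSign_mul_halfGaussTerm {n : ℕ} (hc : c ≠ 0) (hn : Odd n) (hnc : n.Coprime c)
    (x y : ℕ) :
    epsSign n * halfGaussTerm m h (c * n) (x * n + 4 * c * y) =
      jacobiSym (Int.negOnePow m) n *
        (halfGaussTerm m h c x * (jacobiSym y n * expTwoPiI ((h : ℂ) * y / n))) := by
  rcases Nat.even_or_odd x with hx | hx
  · have hd : Even (x * n + 4 * c * y) := (hx.mul_right n).add ⟨2 * c * y, by ring⟩
    rw [halfGaussTerm_eq_zero_of_even m h hd, halfGaussTerm_eq_zero_of_even m h hx]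
    simp only [mul_zero, zero_mul]
  · have hd : x * n + 4 * c * y ≡ x * n [MOD 4] := by
      rw [mul_assoc]
      exact Nat.add_mul_mod_self_left _ 4 _
    have hexp : expTwoPiI ((h : ℂ) * (x * n + 4 * c * y : ℕ) / (4 * (c * n) : ℕ)) =
        expTwoPiI ((h : ℂ) * x / (4 * c : ℕ)) * expTwoPiI ((h : ℂ) * y / n) := by
      have hc' : (c : ℂ) ≠ 0 := by exact_mod_cast hc
      have hn' : (n : ℂ) ≠ 0 := by exact_mod_cast hn.pos.ne'
      rw [← expTwoPiI_add]
      congr 1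
      push_cast
      field_simp
    rw [halfGaussTerm, halfGaussTerm, jacobiSym_twistedInt_mul m hn hnc hx, hexp,
      ← epsSign_mul_qrSign_mul_epsSign hx hn hd]
    push_cast
    ring

theorem epsSign_mul_halfGaussSum_mul {n : ℕ} (hc : c ≠ 0) (hn : Odd n) (hnc : n.Coprime c) :
    epsSign n * halfGaussSum m h (4 * (c * n)) =
      jacobiSym (Int.negOnePow m) n * (halfGaussSum m h (4 * c) * jacobiGaussSum h n) := by
  have hcop : (4 * c).Coprime n := .mul_left (hn.coprime_two_left.pow_left 2) hnc.symm
  have hperiodic := halfGaussTerm_periodic m h (mul_ne_zero hc hn.pos.ne')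
  rw [← mul_assoc] at hperiodic
  rw [← sum_halfGaussTerm, ← mul_assoc, sum_range_mul_of_periodic (by omega) hn.pos.ne' hcop
    hperiodic, ← sum_halfGaussTerm, jacobiGaussSum, Finset.sum_mul_sum]
  simp only [Finset.mul_sum, epsSign_mul_halfGaussTerm m h hc hn hnc]

theorem halfGaussSum_mul_prime {p : ℕ} (hc : c ≠ 0) (hp : p.Prime) (hpc : p.Coprime c)
    (hph : p.Coprime (2 * h.natAbs)) :
    halfGaussSum m h (4 * (c * p)) =
      halfGaussSum m h (4 * c) * (jacobiSym (twistedInt m h) p * √p) := by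
  have hp_odd : Odd p := Nat.coprime_two_right.mp hph.coprime_mul_right_right
  have hp_ndvd : ¬ (p : ℤ) ∣ h := by
    rw [Int.natCast_dvd]
    exact hp.coprime_iff_not_dvd.mp hph.coprime_mul_left_right
  apply mul_left_cancel₀ (epsSign_ne_zero hp_odd)
  rw [epsSign_mul_halfGaussSum_mul m h hc hp_odd hpc,
    jacobiGaussSum_prime hp (Nat.succ_le_iff.mp (hp.odd_iff.mp hp_odd)).ne' hp_ndvd, twistedInt,
    jacobiSym.mul_left]
  push_cast
  ring

theorem halfGaussSum_mul_of_squarefree {n : ℕ} (hc : c ≠ 0) (hn : Squarefree n)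
    (hnc : n.Coprime c) (hnh : n.Coprime (2 * h.natAbs)) :
    halfGaussSum m h (4 * (c * n)) =
      halfGaussSum m h (4 * c) * (jacobiSym (twistedInt m h) n * √n) := by
  induction n using Nat.recOnMul generalizing c with
  | zero => exact absurd hn not_squarefree_zero
  | one => simp
  | prime p hp => exact halfGaussSum_mul_prime m h hc hp hnc hnh
  | mul a b iha ihb =>
    obtain ⟨hab, ha, hb⟩ := Nat.squarefree_mul_iff.mp hn
    have : NeZero a := ⟨ha.ne_zero⟩
    have : NeZero b := ⟨hb.ne_zero⟩
    rw [← mul_assoc c, ihb (mul_ne_zero hc ha.ne_zero) hb (hnc.coprime_mul_left.mul_right hab.symm)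
      hnh.coprime_mul_left, iha hc ha hnc.coprime_mul_right hnh.coprime_mul_right,
      jacobiSym.mul_right, Nat.cast_mul, Real.sqrt_mul (Nat.cast_nonneg a)]
    push_cast
    ring

end HalfGaussSum

section SquarefreeSeries

theorem hasProd_one_add_of_summable_norm {F : Type*} [NormedField F] [CompleteSpace F]
    {f : ℕ →*₀ F} (hf : Summable (‖f ·‖)) :
    HasProd (fun p : Nat.Primes => 1 + f p) (∑' n, if Squarefree n then f n else 0) := by
  have hsum : Summable fun n : ℕ => ‖if Squarefree n then f n else 0‖ :=
    hf.of_nonneg_of_le (fun n => norm_nonneg _) fun n => by split_ifs <;> simp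
  have hmul {m n : ℕ} (hmn : m.Coprime n) : (if Squarefree (m * n) then f (m * n) else 0) =
      (if Squarefree m then f m else 0) * if Squarefree n then f n else 0 := by
    by_cases hm : Squarefree m <;> by_cases hn : Squarefree n <;>
      simp [Nat.squarefree_mul hmn, hm, hn]
  have hlocal (p : Nat.Primes) :
      ∑' e, (if Squarefree ((p : ℕ) ^ e) then f ((p : ℕ) ^ e) else 0) = 1 + f p := by
    rw [tsum_eq_sum (s := Finset.range 2)]
    · simp [Finset.sum_range_succ, p.2.prime.squarefree]
    · intro e he
      rw [Finset.mem_range, not_lt] at he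
      exact if_neg fun h => by
        have := (Nat.squarefree_pow_iff p.2.ne_one (by lia)).mp h
        lia
  simpa only [hlocal] using EulerProduct.eulerProduct_hasProd
    (f := fun n => if Squarefree n then f n else 0) (by simp) hmul hsum (by simp)

theorem tsum_squarefree_mul_tsum_sq {F : Type*} [NormedField F] [CompleteSpace F] {f : ℕ →*₀ F}
    (hf : Summable (‖f ·‖)) :
    (∑' n, if Squarefree n then f n else 0) * ∑' n, f n ^ 2 = ∑' n, f n := by
  have hlt (p : Nat.Primes) : ‖f p‖ < 1 :=
    Summable.norm_lt_one (f := (f : ℕ →* F)) hf.of_norm p.2.one_lt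
  have hsq : HasProd (fun p : Nat.Primes => (1 - f p ^ 2)⁻¹) (∑' n, f n ^ 2) := by
    obtain ⟨g, hg⟩ : ∃ g : ℕ →*₀ F, ∀ n, g n = f n ^ 2 :=
      ⟨(powMonoidWithZeroHom two_ne_zero).comp f, fun n => rfl⟩
    have hsum : Summable (‖g ·‖) := by
      simpa only [Function.comp_def, hg, map_pow] using
        hf.comp_injective (Nat.pow_left_injective two_ne_zero)
    simpa only [hg] using EulerProduct.eulerProduct_completely_multiplicative_hasProd hsum
  refine ((hasProd_one_add_of_summable_norm hf).mul hsq).unique ?_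
  convert EulerProduct.eulerProduct_completely_multiplicative_hasProd hf using 2 with p
  have hadd : 1 + f p ≠ 0 := fun h0 => by
    have := hlt p
    rw [← norm_neg, ← eq_neg_of_add_eq_zero_left h0, norm_one] at this
    exact this.false
  rw [← one_pow 2, sq_sub_sq, one_pow, mul_inv, mul_inv_cancel_left₀ hadd]

theorem hasSum_squarefree_dirichletCharacter {N : ℕ} [NeZero N] (χ : DirichletCharacter ℂ N) {s : ℂ}
    (hs : 1 < s.re) :
    HasSum (fun n : ℕ => if Squarefree n then χ n * (n : ℂ) ^ (-s) else 0)
      (χ.LFunction s / (χ ^ 2).LFunction (2 * s)) := by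
  have hs2 : 1 < (2 * s).re := by
    rw [Complex.mul_re, Complex.re_ofNat, Complex.im_ofNat]
    linarith
  have hsum := summable_dirichletSummand χ hs
  have hsq : ∑' n : ℕ, dirichletSummandHom χ (Complex.ne_zero_of_one_lt_re hs) n ^ 2 =
      (χ ^ 2).LFunction (2 * s) := by
    rw [DirichletCharacter.LFunction_eq_LSeries _ hs2, ← tsum_dirichletSummand (χ ^ 2) hs2]
    refine tsum_congr fun n => ?_
    simp only [dirichletSummandHom, MonoidWithZeroHom.coe_mk, ZeroHom.coe_mk, mul_pow,
      MulChar.pow_apply' _ two_ne_zero]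
    rw [← Complex.cpow_nat_mul, Nat.cast_two, mul_neg]
  have hne : (χ ^ 2).LFunction (2 * s) ≠ 0 :=
    (χ ^ 2).LFunction_ne_zero_of_one_le_re (.inr fun h => by simp [h] at hs2) hs2.le
  have key := tsum_squarefree_mul_tsum_sq hsum
  rw [hsq, tsum_dirichletSummand χ hs, ← DirichletCharacter.LFunction_eq_LSeries _ hs,
    ← eq_div_iff hne] at key
  rw [← key]
  refine (Summable.of_norm ?_).hasSum
  refine hsum.of_nonneg_of_le (fun n => norm_nonneg _) fun n => ?_
  split_ifs
  · exact le_rfl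
  · rw [norm_zero]
    exact norm_nonneg _

end SquarefreeSeries

section GcdDecomposition

theorem hasSum_of_eq_mul_of_coprime {R : Type*} [NonUnitalNonAssocSemiring R] [TopologicalSpace R]
    [IsTopologicalSemiring R] {D : ℕ} (hD : D ≠ 0) {F A b : ℕ → R} {S : R} (hb : HasSum b S)
    (hb0 : ∀ n, ¬ n.Coprime D → b n = 0) (hF0 : ∀ c, ¬ (c / c.gcd D).Coprime D → F c = 0)
    (hmul : ∀ u ∈ D.divisors, ∀ n, n.Coprime D → F (u * n) = A u * b n) :
    HasSum F ((∑ u ∈ D.divisors, A u) * S) := by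
  have hfiber : ∀ u ∈ D.divisors,
      HasSum (fun c => if c.gcd D = u then F c else 0) (A u * S) := by
    intro u hu
    have hu0 : 0 < u := Nat.pos_of_mem_divisors hu
    have hinj : Function.Injective (u * ·) := fun _ _ => Nat.eq_of_mul_eq_mul_left hu0
    refine (hinj.hasSum_iff fun c hc => if_neg ?_).mp ?_
    · rintro rfl
      obtain ⟨n, hn⟩ := Nat.gcd_dvd_left c D
      exact hc ⟨n, hn.symm⟩
    · convert hb.mul_left (A u) using 2 with n
      rw [Function.comp_apply]
      by_cases hn : n.Coprime D
      · rw [hn.gcd_mul_right_cancel, if_pos (Nat.gcd_eq_left (Nat.dvd_of_mem_divisors hu)),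
          hmul u hu n hn]
      · rw [hb0 n hn, mul_zero]
        refine ite_eq_right_iff.mpr fun hgcd => hF0 _ ?_
        rwa [hgcd, Nat.mul_div_cancel_left n hu0]
  rw [Finset.sum_mul]
  convert hasSum_sum hfiber using 2 with c
  rw [Finset.sum_ite_eq, if_pos (Nat.mem_divisors.mpr ⟨Nat.gcd_dvd_right c D, hD⟩)]

theorem exists_prime_pow_dvd_of_not_coprime_div_gcd {c D : ℕ} (hc : c ≠ 0)
    (h : ¬ (c / c.gcd D).Coprime D) :
    ∃ p j : ℕ, p.Prime ∧ p ∣ D ∧ p ^ (j + 1) ∣ c ∧ ¬ p ^ (j + 1) ∣ D := by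
  obtain ⟨p, hp, hpc, hpD⟩ := Nat.Prime.not_coprime_iff_dvd.mp h
  obtain ⟨j, r, hr, hgcd⟩ :=
    Nat.exists_eq_pow_mul_and_not_dvd (Nat.gcd_ne_zero_left (n := D) hc) p hp.ne_one
  have hpow : p ^ (j + 1) ∣ c := by
    rw [← Nat.mul_div_cancel' (Nat.gcd_dvd_left c D), pow_succ]
    exact mul_dvd_mul (hgcd ▸ dvd_mul_right _ _) hpc
  refine ⟨p, j, hp, hpD, hpow, fun hpowD => hr ?_⟩
  have hdvd := Nat.dvd_gcd hpow hpowD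
  rw [hgcd, pow_succ] at hdvd
  exact Nat.dvd_of_mul_dvd_mul_left (pow_pos hp.pos j) hdvd

end GcdDecomposition

section LFunctions

theorem quadraticSymbolChar_natCast (a : ℤ) [NeZero a] {n : ℕ} (hn : n.Coprime (4 * a.natAbs)) :
    quadraticSymbolChar a n = jacobiSym a n := by
  have hodd : Odd n := Nat.coprime_two_right.mp (hn.coprime_dvd_right ⟨2 * a.natAbs, by ring⟩)
  have hu := (ZMod.isUnit_iff_coprime n (4 * a.natAbs)).mpr hn
  change (if IsUnit (n : ZMod (4 * a.natAbs)) then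
    (kroneckerSym a (n : ZMod (4 * a.natAbs)).val : ℂ) else 0) = _
  rw [if_pos hu, ZMod.val_natCast, kroneckerSym_odd a (hodd.mod_even ⟨2 * a.natAbs, by ring⟩),
    ← jacobiSym.mod_right a hodd]

theorem quadraticSymbolChar_sq (a : ℤ) [NeZero a] : quadraticSymbolChar a ^ 2 = 1 := by
  ext x
  obtain ⟨n, hn⟩ := ZMod.natCast_zmod_surjective (x : ZMod (4 * a.natAbs))
  have hcop := (ZMod.isUnit_iff_coprime n (4 * a.natAbs)).mp (hn ▸ x.isUnit)
  rw [MulChar.pow_apply' _ two_ne_zero, MulChar.one_apply_coe, ← hn,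
    quadraticSymbolChar_natCast a hcop]
  exact_mod_cast jacobiSym.sq_one (hcop.symm.coprime_dvd_left (dvd_mul_left _ 4))

theorem LFunction_one_eq_partialZeta (n : ℕ) [NeZero (4 * n)] {s : ℂ} (hs : s ≠ 1) :
    (1 : DirichletCharacter ℂ (4 * n)).LFunction s = partialZeta (2 * n) s := by
  have hn : n ≠ 0 := right_ne_zero_of_mul (NeZero.ne (4 * n))
  have hprimes : (4 * n).primeFactors = (2 * n).primeFactors := by
    rw [Nat.primeFactors_mul four_ne_zero hn, Nat.primeFactors_mul two_ne_zero hn,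
      show 4 = 2 ^ 2 from rfl, Nat.primeFactors_pow 2 two_ne_zero]
  exact (DirichletCharacter.LFunctionTrivChar_eq_mul_riemannZeta hs).trans
    (by rw [partialZeta, mul_comm, hprimes])

theorem partialLFunction_of_dvd {N Q : ℕ} [NeZero N] (χ : DirichletCharacter ℂ N) (s : ℂ)
    (hQ : Q ∣ N) : partialLFunction Q χ s = χ.LFunction s := by
  rw [partialLFunction, Finset.prod_eq_one, mul_one]
  intro p hp
  obtain ⟨hp, hpQ, -⟩ := Nat.mem_primeFactors.mp hp
  have hunit : ¬ IsUnit (p : ZMod N) := by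
    rw [ZMod.isUnit_prime_iff_not_dvd hp, not_not]
    exact hpQ.trans hQ
  rw [χ.map_nonunit hunit, zero_mul, sub_zero]

theorem partialLFunction_mul_prod_sdiff {M N Q : ℕ} [NeZero M] (χ : DirichletCharacter ℂ M) (s : ℂ)
    (hN : N ≠ 0) (hQ : Q ∣ N) :
    partialLFunction Q χ s * ∏ p ∈ N.primeFactors \ Q.primeFactors, (1 - χ p * (p : ℂ) ^ (-s)) =
      partialLFunction N χ s := by
  rw [partialLFunction, partialLFunction, mul_assoc, mul_comm (∏ p ∈ Q.primeFactors, _),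
    Finset.prod_sdiff (Nat.primeFactors_mono hQ hN)]

theorem partialLFunction_primitiveCharacter {N : ℕ} [NeZero N] (χ : DirichletCharacter ℂ N) {s : ℂ}
    (hs : s ≠ 1) : partialLFunction N χ.primitiveCharacter s = χ.LFunction s := by
  rw [partialLFunction,
    ← DirichletCharacter.LFunction_changeLevel χ.conductor_dvd_level _ (.inr hs),
    DirichletCharacter.changeLevel_primitiveCharacter]

end LFunctions

section DirichletPolynomials

/-- The algebra of functions of a complex variable given by a finite Dirichlet polynomial. -/
noncomputable def dirichletPolynomials : Subalgebra ℂ (ℂ → ℂ) :=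
  (MonoidAlgebra.lift ℂ (ℂ → ℂ) ℕ+
    { toFun n s := ((n : ℕ) : ℂ) ^ (-s)
      map_one' := by ext; simp
      map_mul' a b := by ext; simp [Complex.natCast_mul_natCast_cpow] }).range

theorem mem_dirichletPolynomials {f : ℂ → ℂ} :
    f ∈ dirichletPolynomials ↔ ∃ a : ℕ+ →₀ ℂ, dirichletPolynomial a = f := by
  have happly (a : ℕ+ →₀ ℂ) : dirichletPolynomial a =
      a.sum fun n z => z • fun s : ℂ => ((n : ℕ) : ℂ) ^ (-s) := by
    ext s
    simp [dirichletPolynomial, Finsupp.sum]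
  simp only [dirichletPolynomials, AlgHom.mem_range, MonoidAlgebra.lift_apply, happly]
  exact ⟨fun ⟨x, hx⟩ => ⟨x.coeff, hx⟩, fun ⟨a, ha⟩ => ⟨.ofCoeff a, ha⟩⟩

theorem natCast_cpow_sub_mem_dirichletPolynomials {n : ℕ} (hn : n ≠ 0) (t : ℂ) :
    (fun s => (n : ℂ) ^ (t - s)) ∈ dirichletPolynomials := by
  rw [mem_dirichletPolynomials]
  lift n to ℕ+ using hn.bot_lt
  refine ⟨.single n ((n : ℂ) ^ t), funext fun s => ?_⟩
  rw [dirichletPolynomial, Finsupp.sum_single_index (zero_mul _), sub_eq_add_neg,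
    Complex.cpow_add _ _ (Nat.cast_ne_zero.mpr hn)]

theorem prod_one_sub_cpow_mem_dirichletPolynomials (S : Finset ℕ) (hS : ∀ n ∈ S, n ≠ 0)
    (z : ℕ → ℂ) (t : ℂ) :
    (fun s => ∏ n ∈ S, (1 - z n * (n : ℂ) ^ (t - s))) ∈ dirichletPolynomials := by
  have heq : (fun s => ∏ n ∈ S, (1 - z n * (n : ℂ) ^ (t - s))) =
      ∏ n ∈ S, (1 - z n • fun s : ℂ => (n : ℂ) ^ (t - s)) := by
    ext s
    simp
  rw [heq]
  exact prod_mem fun n hn => sub_mem (one_mem _) (dirichletPolynomials.smul_mem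
    (natCast_cpow_sub_mem_dirichletPolynomials (hS n hn) t) _)

theorem exists_LFunction_eq_partialLFunction_primitiveCharacter_mul {N Q : ℕ} [NeZero N]
    (χ : DirichletCharacter ℂ N) (hQ : Q ∣ N) (t : ℂ) :
    ∃ P ∈ dirichletPolynomials, ∀ s, s - t ≠ 1 →
      χ.LFunction (s - t) = partialLFunction Q χ.primitiveCharacter (s - t) * P s := by
  refine ⟨_, prod_one_sub_cpow_mem_dirichletPolynomials (N.primeFactors \ Q.primeFactors)
    (fun p hp => ?_) (fun p => χ.primitiveCharacter p) t, fun s hs => ?_⟩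
  · exact (Nat.prime_of_mem_primeFactors (Finset.mem_sdiff.mp hp).1).ne_zero
  · rw [← partialLFunction_primitiveCharacter χ hs,
      ← partialLFunction_mul_prod_sdiff _ _ (NeZero.ne N) hQ]
    simp only [neg_sub]

end DirichletPolynomials

section GaussSumSeries

variable (m h : ℤ)

theorem halfGaussSum_mul_of_coprime {c n : ℕ} (hc : c ≠ 0) (hnc : n.Coprime c)
    (hnh : n.Coprime (2 * h.natAbs)) :
    halfGaussSum m h (4 * (c * n)) = halfGaussSum m h (4 * c) *
      if Squarefree n then (jacobiSym (twistedInt m h) n : ℂ) * √n else 0 := by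
  split_ifs with hsq
  · exact halfGaussSum_mul_of_squarefree m h hc hsq hnc hnh
  · obtain ⟨p, hp, hpn⟩ : ∃ p, p.Prime ∧ p * p ∣ n := by
      simpa [Nat.squarefree_iff_prime_squarefree] using hsq
    rw [mul_zero]
    refine halfGaussSum_eq_zero_of_pow_dvd m h (b := p) (j := 1)
      (dvd_mul_of_dvd_right (by rwa [one_add_one_eq_two, pow_two]) c) fun hph => hp.one_lt.ne' ?_
    rw [pow_one, Int.natCast_dvd] at hph
    exact Nat.eq_one_of_dvd_coprimes hnh (dvd_of_mul_right_dvd hpn) (hph.mul_left 2)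

theorem halfGaussSum_eq_zero_of_not_coprime {c : ℕ}
    (hcop : ¬ (c / c.gcd (2 * h.natAbs ^ 2)).Coprime (2 * h.natAbs ^ 2)) :
    halfGaussSum m h (4 * c) = 0 := by
  rcases eq_or_ne c 0 with rfl | hc
  · exact Finset.sum_range_zero _
  obtain ⟨p, j, -, hpD, hpc, hpj⟩ := exists_prime_pow_dvd_of_not_coprime_div_gcd hc hcop
  refine halfGaussSum_eq_zero_of_pow_dvd m h hpc fun hph => hpj ?_
  rw [Int.natCast_dvd] at hph
  rcases Nat.eq_zero_or_pos j with rfl | hj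
  · rwa [zero_add, pow_one]
  · rw [pow_succ, pow_two]
    exact (mul_dvd_mul hph ((dvd_pow_self p hj.ne').trans hph)).mul_left 2

theorem halfGaussSum_div_cpow_mul_of_coprime [NeZero h] {c n : ℕ} (hc : c ≠ 0)
    (hnc : n.Coprime c) (hnh : n.Coprime (2 * h.natAbs)) (s : ℂ) :
    halfGaussSum m h (4 * (c * n)) / ((4 * (c * n) : ℕ) : ℂ) ^ s =
      halfGaussSum m h (4 * c) / ((4 * c : ℕ) : ℂ) ^ s *
        if Squarefree n then chiSymbol m h n * (n : ℂ) ^ (-(s - 1 / 2)) else 0 := by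
  have hn : n ≠ 0 := by
    rintro rfl
    rw [Nat.coprime_zero_left] at hnh
    lia
  have hchi : chiSymbol m h n = jacobiSym (twistedInt m h) n := by
    refine quadraticSymbolChar_natCast _ ((hnh.pow_right 2).coprime_dvd_right ⟨h.natAbs, ?_⟩)
    rw [natAbs_twistedInt]
    ring
  have hsqrt : (n : ℂ) ^ (-(s - 1 / 2)) = √n / (n : ℂ) ^ s := by
    rw [neg_sub, Complex.cpow_sub _ _ (Nat.cast_ne_zero.mpr hn), Real.sqrt_eq_rpow,
      Complex.ofReal_cpow n.cast_nonneg]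
    norm_num
  rw [halfGaussSum_mul_of_coprime m h hc hnc hnh, ← mul_assoc 4 c n, Nat.cast_mul (4 * c),
    Complex.natCast_mul_natCast_cpow, hchi, hsqrt, mul_div_mul_comm, ite_div, zero_div,
    mul_div_assoc]

theorem LFunction_chiSymbol_sq [NeZero h] {s : ℂ} (hs : s ≠ 1) :
    (chiSymbol m h ^ 2).LFunction s = partialZeta (2 * h.natAbs) s := by
  rw [chiSymbol, quadraticSymbolChar_sq, LFunction_one_eq_partialZeta _ hs, natAbs_twistedInt]

theorem chiSymbol_eq_zero_of_not_coprime [NeZero h] {n : ℕ}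
    (hn : ¬ n.Coprime (2 * h.natAbs ^ 2)) : chiSymbol m h n = 0 := by
  refine MulChar.map_nonunit _ fun hunit => hn ?_
  rw [ZMod.isUnit_iff_coprime, natAbs_twistedInt] at hunit
  exact (hunit.pow_right 2).coprime_dvd_right ⟨8, by ring⟩

/-- The Dirichlet polynomial formed by the terms of `∑ g_h(4c) (4c)^{-s}` with `c ∣ 2h²`. -/
noncomputable def gaussSumPolynomial (s : ℂ) : ℂ :=
  ∑ u ∈ (2 * h.natAbs ^ 2).divisors, halfGaussSum m h (4 * u) / ((4 * u : ℕ) : ℂ) ^ s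

theorem gaussSumPolynomial_mem_dirichletPolynomials :
    gaussSumPolynomial m h ∈ dirichletPolynomials := by
  have heq : gaussSumPolynomial m h = ∑ u ∈ (2 * h.natAbs ^ 2).divisors,
      halfGaussSum m h (4 * u) • fun s : ℂ => ((4 * u : ℕ) : ℂ) ^ (0 - s) := by
    ext s
    simp only [gaussSumPolynomial, Finset.sum_apply, Pi.smul_apply, smul_eq_mul, zero_sub,
      Complex.cpow_neg, div_eq_mul_inv]
  rw [heq]
  exact sum_mem fun u hu => dirichletPolynomials.smul_mem
    (natCast_cpow_sub_mem_dirichletPolynomials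
      (mul_ne_zero four_ne_zero (Nat.pos_of_mem_divisors hu).ne') 0) _

theorem hasSum_halfGaussSum [NeZero h] {s : ℂ} (hs : 3 / 2 < s.re) :
    HasSum (fun c : ℕ+ => halfGaussSum m h (4 * (c : ℕ)) / ((4 * (c : ℕ) : ℕ) : ℂ) ^ s)
      (gaussSumPolynomial m h s * ((chiSymbol m h).LFunction (s - 1 / 2) /
        partialZeta (2 * h.natAbs) (2 * s - 1))) := by
  have hh : h.natAbs ≠ 0 := Int.natAbs_ne_zero.mpr (NeZero.ne h)
  have hs1 : 1 < (s - 1 / 2).re := by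
    norm_num
    linarith
  have hs2 : 2 * (s - 1 / 2) ≠ 1 := fun hone => by
    have hre := congrArg Complex.re hone
    norm_num at hre hs1
    linarith
  have hb := hasSum_squarefree_dirichletCharacter (chiSymbol m h) hs1
  rw [LFunction_chiSymbol_sq m h hs2, show 2 * (s - 1 / 2) = 2 * s - 1 by ring] at hb
  refine (PNat.coe_injective.hasSum_iff fun c hc => ?_).mpr
    (hasSum_of_eq_mul_of_coprime (D := 2 * h.natAbs ^ 2) (by positivity) hb
      (F := fun c => halfGaussSum m h (4 * c) / ((4 * c : ℕ) : ℂ) ^ s) ?_ ?_ ?_)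
  · obtain rfl : c = 0 := by_contra fun hc0 => hc ⟨⟨c, Nat.pos_of_ne_zero hc0⟩, rfl⟩
    rw [mul_zero, halfGaussSum, Finset.sum_range_zero, zero_div]
  · intro n hn
    rw [chiSymbol_eq_zero_of_not_coprime m h hn, zero_mul, ite_self]
  · intro c hc
    rw [halfGaussSum_eq_zero_of_not_coprime m h hc, zero_div]
  · intro u hu n hn
    exact halfGaussSum_div_cpow_mul_of_coprime m h (Nat.pos_of_mem_divisors hu).ne'
      (hn.coprime_dvd_right (Nat.dvd_of_mem_divisors hu))
      (hn.coprime_dvd_right ⟨h.natAbs, by ring⟩) s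

theorem exists_dirichletPolynomial_hasSum_halfGaussSum [NeZero h] {L P : ℂ → ℂ}
    (hP : P ∈ dirichletPolynomials)
    (hL : ∀ s, s - 1 / 2 ≠ 1 → (chiSymbol m h).LFunction (s - 1 / 2) = L (s - 1 / 2) * P s) :
    ∃ a : ℕ+ →₀ ℂ, ∀ w : ℂ, 3 / 4 < w.re →
      HasSum (fun c : ℕ+ => halfGaussSum m h (4 * (c : ℕ)) / ((4 * (c : ℕ) : ℕ) : ℂ) ^ (2 * w))
        (L (2 * w - 1 / 2) / partialZeta (2 * h.natAbs) (4 * w - 1) *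
          dirichletPolynomial a (2 * w)) := by
  obtain ⟨a, ha⟩ := mem_dirichletPolynomials.mp
    (mul_mem (gaussSumPolynomial_mem_dirichletPolynomials m h) hP)
  refine ⟨a, fun w hw => ?_⟩
  have hs : 3 / 2 < (2 * w).re := by
    norm_num
    linarith
  have hs1 : 2 * w - 1 / 2 ≠ 1 := fun hone => by
    have hre := congrArg Complex.re hone
    norm_num at hre
    linarith
  convert hasSum_halfGaussSum m h hs using 1
  rw [hL _ hs1, ha, Pi.mul_apply, ← mul_assoc 2 2 w]
  ring_nf

end GaussSumSeries

theorem mainTheorem9 (m h : ℤ) [NeZero h] :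
    (∃ a : ℕ+ →₀ ℂ, ∀ w : ℂ, 3 / 4 < w.re →
      HasSum (fun c : ℕ+ => halfGaussSum m h (4 * (c : ℕ)) / ((4 * (c : ℕ) : ℕ) : ℂ) ^ (2 * w))
        (partialLFunction 2 (chiSymbol m h) (2 * w - 1 / 2) /
            partialZeta (2 * h.natAbs) (4 * w - 1) *
          dirichletPolynomial a (2 * w))) ∧
    (∃ a : ℕ+ →₀ ℂ, ∀ w : ℂ, 3 / 4 < w.re →
      HasSum (fun c : ℕ+ => halfGaussSum m h (4 * (c : ℕ)) / ((4 * (c : ℕ) : ℕ) : ℂ) ^ (2 * w))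
        (partialLFunction 2 (chiField m h) (2 * w - 1 / 2) /
            partialZeta (2 * h.natAbs) (4 * w - 1) *
          dirichletPolynomial a (2 * w))) := by
  have htwo : 2 ∣ 4 * (twistedInt m h).natAbs := ⟨2 * (twistedInt m h).natAbs, by ring⟩
  obtain ⟨P, hP, hfield⟩ :=
    exists_LFunction_eq_partialLFunction_primitiveCharacter_mul (chiSymbol m h) htwo (1 / 2)
  have hsymbol (s : ℂ) :
      (chiSymbol m h).LFunction s = partialLFunction 2 (chiSymbol m h) s * 1 := by
    rw [partialLFunction_of_dvd _ _ htwo, mul_one]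
  exact ⟨exists_dirichletPolynomial_hasSum_halfGaussSum m h (one_mem _) fun s _ => hsymbol _,
    exists_dirichletPolynomial_hasSum_halfGaussSum m h hP hfield⟩
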